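/- **Theorem 2 (Global stability of the equilibrium point).** Two agents x and y have baseline demands $X_1,X_2$ and $Y_1,Y_2$ in periods 1 and 2. Put $S_{b,1}=X_1+Y_1$, $S_{b,2}=X_2+Y_2$ and assume $0\le S_{b,1}<S_{b,2}$. Let $\pi>0$ be the coincident-peak price and $\alpha_x,\alpha_y>0$ the shifting penalties. If x and y shift the amounts $x,y\in\mathbb R$ from period 2 to period 1, the system demands are $S_1=S_{b,1}+x+y$ and $S_2=S_{b,2}-x-y$. The payoffs when period 1, respectively period 2, is the peak period are $$f_{x,1}(x)=-\pi(X_1+x)-\alpha_x x^2,\qquad f_{x,2}(x)=-\pi(X_2-x)-\alpha_x x^2,$$ and $f_{y,1},f_{y,2}$ are defined in the same way from $Y_1,Y_2,\alpha_y$. Let $$F_1(x,y)=\bigl(-(\pi+2\alpha_x x),\,-(\pi+2\alpha_y y)\bigr),\qquad F_2(x,y)=\bigl(\pi-2\alpha_x x,\,\pi-2\alpha_y y\bigr),$$ and consider the switched gradient dynamics $$(\dot x,\dot y)=F_1(x,y)\ \text{ if } S_1(x,y)\ge S_2(x,y),\qquad (\dot x,\dot y)=F_2(x,y)\ \text{ if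 } S_1(x,y)<S_2(x,y),$$ whose solutions are understood in the sense of Filippov on $[0,\infty)$. Let $$\mathcal X_s=\{(x,y):\ \alpha_x x^2+\alpha_y y^2+\pi(S_{b,1}+x+y)>0\ \text{ and }\ \alpha_x x^2+\alpha_y y^2+\pi(S_{b,2}-x-y)>0\}.$$ Call $(x^*,y^*)$ an equilibrium point of the system if $$\text{(a)}\ \ f_{x,1}(x^*)+f_{y,1}(y^*)=f_{x,2}(x^*)+f_{y,2}(y^*)\qquad\text{or}\qquad\text{(b)}\ \ F_2(x^*,y^*)=0 .$$ Then from every starting point in $\mathcal X_s$ there is exactly one solution, and there is an equilibrium point $(x^*,y^*)\in\mathcal X_s$, the same for all starting points, such that the system is globally uniformly asymptotically stable at $(x^*,y^*)$ in $\mathcal X_s$: there is a class $\mathcal{KL}$ function $\beta$ such that every solution $z(k)=(x(k),y(k))$ with $z(0)\in\mathcal X_s$ satisfies $\|z(k)-(x^*,y^*)\|\le\beta(\|z(0)-(x^*,y^*)\|,k)$ for all $k\ge0$. In particular every such solution converges to $(x^*,y^*)$ as $k\to\infty$. With $r_x=\pi/(2\alpha_x)$, $r_y=\pi/(2\alpha_y)$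 and $b=(S_{b,2}-S_{b,1})/2$, the point $(x^*,y^*)$ satisfies (b) if $b>r_x+r_y$ (concave game), and (a) if $b\le r_x+r_y$ (quasiconcave and non-concave games). -/

import Mathlib

open Set Filter Topology MeasureTheory

/-! ### General notions: Filippov solutions and global uniform asymptotic stability -/

/-- The plane `ℝ²` with its Euclidean norm; a point `z` has coordinates `x = z 0`, `y = z 1`. -/
abbrev Plane : Type := EuclideanSpace ℝ (Fin 2)

/-- Filippov's set-valued regularization of a (possibly discontinuous) vector field `F`:
the intersection, over all radii `δ > 0` and all Lebesgue-null sets `N`, of the closed convex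
hulls of the values of `F` on the ball of radius `δ` around `z` with `N` removed. -/
def filippovSet (F : Plane → Plane) (z : Plane) : Set Plane :=
  ⋂ (δ : ℝ) (_ : 0 < δ) (N : Set Plane) (_ : volume N = 0),
    closure (convexHull ℝ (F '' (Metric.ball z δ \ N)))

/-- `z` restricted to `[0, ∞)` is a Filippov solution of `ż = F(z)`: it is absolutely continuous
on every compact interval `[0, T]`, and at almost every time `t > 0` it has a derivative which
belongs to the Filippov set of `F` at `z t`. The values of `z` at negative times play no role. -/
structure IsFilippovSolution (F : Plane → Plane) (z : ℝ → Plane) : Prop where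
  absolutelyContinuous : ∀ T : ℝ, 0 ≤ T → AbsolutelyContinuousOnInterval z 0 T
  hasDerivAt_ae : ∀ᵐ t ∂(volume.restrict (Ioi (0 : ℝ))),
    ∃ v ∈ filippovSet F (z t), HasDerivAt z v t

/-- Class `K` functions `[0, ∞) → [0, ∞)`: continuous, strictly increasing, zero at zero. -/
structure IsClassK (γ : ℝ → ℝ) : Prop where
  continuousOn : ContinuousOn γ (Ici 0)
  strictMonoOn : StrictMonoOn γ (Ici 0)
  map_zero : γ 0 = 0

/-- Class `KL` functions `[0, ∞) × [0, ∞) → [0, ∞)`: `β (·, t)` is of class `K` for each `t ≥ 0`,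
and `β (r, ·)` decreases to zero for each `r ≥ 0`. -/
structure IsClassKL (β : ℝ → ℝ → ℝ) : Prop where
  classK : ∀ t : ℝ, 0 ≤ t → IsClassK fun r => β r t
  antitoneOn : ∀ r : ℝ, 0 ≤ r → AntitoneOn (β r) (Ici 0)
  tendsto_zero : ∀ r : ℝ, 0 ≤ r → Tendsto (β r) atTop (𝓝 0)

/-- The system `ż = F(z)` is globally uniformly asymptotically stable at `p` in the region `D`:
one class `KL` estimate holds along every solution that starts in `D`. -/
def IsGUAS (F : Plane → Plane) (D : Set Plane) (p : Plane) : Prop :=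
  ∃ β : ℝ → ℝ → ℝ, IsClassKL β ∧
    ∀ z : ℝ → Plane, IsFilippovSolution F z → z 0 ∈ D →
      ∀ t : ℝ, 0 ≤ t → ‖z t - p‖ ≤ β ‖z 0 - p‖ t

/-! ### The two-agent two-period coincident-peak shaving game -/

/-- The data of the game: baseline demands `X₁, X₂` of agent x and `Y₁, Y₂` of agent y in the
periods 1 and 2, the coincident-peak price, and the shifting penalties of the two agents. -/
structure CPGame where
  X₁ : ℝ
  X₂ : ℝ
  Y₁ : ℝ
  Y₂ : ℝ
  price : ℝ
  αx : ℝ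
  αy : ℝ

namespace CPGame

noncomputable section

variable (G : CPGame)

/-- System baseline demand in period 1. -/
def Sb₁ : ℝ := G.X₁ + G.Y₁

/-- System baseline demand in period 2. -/
def Sb₂ : ℝ := G.X₂ + G.Y₂

/-- System demand in period 1 after shifting. -/
def S₁ (z : Plane) : ℝ := G.Sb₁ + z 0 + z 1

/-- System demand in period 2 after shifting. -/
def S₂ (z : Plane) : ℝ := G.Sb₂ - z 0 - z 1

/-- Critical point of agent x. -/
def rx : ℝ := G.price / (2 * G.αx)

/-- Critical point of agent y. -/
def ry : ℝ := G.price / (2 * G.αy)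

/-- System balance point. -/
def b : ℝ := (G.Sb₂ - G.Sb₁) / 2

/-- Payoff of agent x when period 1 is the peak period. -/
def fx₁ (x : ℝ) : ℝ := -G.price * (G.X₁ + x) - G.αx * x ^ 2

/-- Payoff of agent x when period 2 is the peak period. -/
def fx₂ (x : ℝ) : ℝ := -G.price * (G.X₂ - x) - G.αx * x ^ 2

/-- Payoff of agent y when period 1 is the peak period. -/
def fy₁ (y : ℝ) : ℝ := -G.price * (G.Y₁ + y) - G.αy * y ^ 2

/-- Payoff of agent y when period 2 is the peak period. -/
def fy₂ (y : ℝ) : ℝ := -G.price * (G.Y₂ - y) - G.αy * y ^ 2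

/-- Gradient dynamics in period 1: each agent follows the derivative of its own payoff. -/
def F₁ (z : Plane) : Plane :=
  !₂[-(G.price + 2 * G.αx * z 0), -(G.price + 2 * G.αy * z 1)]

/-- Gradient dynamics in period 2: each agent follows the derivative of its own payoff. -/
def F₂ (z : Plane) : Plane :=
  !₂[G.price - 2 * G.αx * z 0, G.price - 2 * G.αy * z 1]

theorem hasDerivAt_payoff₁ (z : Plane) :
    HasDerivAt G.fx₁ (G.F₁ z 0) (z 0) ∧ HasDerivAt G.fy₁ (G.F₁ z 1) (z 1) := by
  constructor
  · have h := (((hasDerivAt_id (z 0)).const_add G.X₁).const_mul (-G.price)).sub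
      ((hasDerivAt_pow 2 (z 0)).const_mul G.αx)
    refine h.congr_deriv ?_
    simp [F₁]; ring
  · have h := (((hasDerivAt_id (z 1)).const_add G.Y₁).const_mul (-G.price)).sub
      ((hasDerivAt_pow 2 (z 1)).const_mul G.αy)
    refine h.congr_deriv ?_
    simp [F₁]; ring

theorem hasDerivAt_payoff₂ (z : Plane) :
    HasDerivAt G.fx₂ (G.F₂ z 0) (z 0) ∧ HasDerivAt G.fy₂ (G.F₂ z 1) (z 1) := by
  constructor
  · have h := (((hasDerivAt_id (z 0)).const_sub G.X₂).const_mul (-G.price)).sub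
      ((hasDerivAt_pow 2 (z 0)).const_mul G.αx)
    refine h.congr_deriv ?_
    simp [F₂]; ring
  · have h := (((hasDerivAt_id (z 1)).const_sub G.Y₂).const_mul (-G.price)).sub
      ((hasDerivAt_pow 2 (z 1)).const_mul G.αy)
    refine h.congr_deriv ?_
    simp [F₂]; ring

open Classical in
/-- The switched gradient dynamics: `F₁` where period 1 is the peak period (`S₁ ≥ S₂`),
`F₂` where period 2 is (`S₁ < S₂`). -/
def switchedField (z : Plane) : Plane := if G.S₂ z ≤ G.S₁ z then G.F₁ z else G.F₂ z

/-- The region where both quadratic expressions are positive. -/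
def Xs : Set Plane :=
  {z | 0 < G.αx * z 0 ^ 2 + G.αy * z 1 ^ 2 + G.price * (G.Sb₁ + z 0 + z 1) ∧
       0 < G.αx * z 0 ^ 2 + G.αy * z 1 ^ 2 + G.price * (G.Sb₂ - z 0 - z 1)}

/-- The total payoffs of the two agents in the two periods agree at `p`. -/
def EqualPayoffs (p : Plane) : Prop :=
  G.fx₁ (p 0) + G.fy₁ (p 1) = G.fx₂ (p 0) + G.fy₂ (p 1)

/-- Equilibrium points of the switched system. -/
def IsEquilibriumPoint (p : Plane) : Prop := G.EqualPayoffs p ∨ G.F₂ p = 0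

end

end CPGame

/-!
The switched field is minus the gradient of the strongly convex function
`V(x, y) = αx x² + αy y² + π |x + y - b|`, because `S₁ - S₂ = 2 (x + y - b)`, and its Filippov set
is minus the subdifferential of `V` (`CPGame.filippovSet_switchedField`): the velocities
`-2αz - π u (1, 1)` with `u` in the set-valued sign of `x + y - b`. Everything follows from this,
on the whole plane; the region `Xs` matters only in that it contains the equilibrium.

*Uniqueness and stability.* The subdifferential of `V` is strongly monotone with constant
`2m = 2 min αx αy`. Along two solutions `z, w` the absolutely continuous function
`exp (4mt) ‖z t - w t‖²` therefore has a nonpositive derivative almost everywhere, so that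
`‖z t - w t‖ ≤ exp (-2mt) ‖z 0 - w 0‖` (`CPGame.norm_sub_le_of_isFilippovSolution`). With
`z 0 = w 0` this is uniqueness; with `w` constant at the minimizer `p` of `V` it is the class `KL`
estimate with `β(r, t) = r exp (-2mt)`.

*Existence.* The sign is replaced by a saturation of slope `n + 1`, and the resulting Lipschitz
equation is solved on `[0, n + 1]`. The saturations of two slopes `k, l` are monotone up to an
error `O(1/k + 1/l)` (`saturation_almost_monotone`), so the computation above shows that the
approximations form a Cauchy sequence at each time. They are equi-Lipschitz, hence so is the limit,
which is differentiable almost everywhere; the relations that define the subdifferential are linear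
equations and inequalities between velocities, and these pass to the limit (`deriv_limit_le`).

*The equilibrium.* The minimizer of `V` is `(rx, ry)` if `rx + ry < b`. Otherwise it is the point
of the line `x + y = b`, on which the total payoffs agree, where `αx x = αy y`.
-/

open scoped NNReal

/-! ### The Filippov set of the switched field -/

/-- An upper bound for a linear functional of the field, valid near `z` and continuous at `z`,
is inherited by every element of the Filippov set at `z`. -/
theorem le_of_mem_filippovSet {F : Plane → Plane} {z v : Plane} (hv : v ∈ filippovSet F z)
    (l : Plane →L[ℝ] ℝ) {g : Plane → ℝ} (hg : ContinuousAt g z)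
    (h : ∀ᶠ w in 𝓝 z, l (F w) ≤ g w) : l v ≤ g z := by
  refine le_of_forall_pos_le_add fun ε hε => ?_
  have hg' : ∀ᶠ w in 𝓝 z, g w < g z + ε := hg.eventually_lt_const (by linarith)
  obtain ⟨δ, hδ, hball⟩ := Metric.eventually_nhds_iff_ball.1 (h.and hg')
  simp only [filippovSet, mem_iInter] at hv
  have hv' := hv δ hδ ∅ measure_empty
  have hsub : closure (convexHull ℝ (F '' (Metric.ball z δ \ ∅))) ⊆ {w | l w ≤ g z + ε} := by
    refine closure_minimal (convexHull_min ?_ ?_) ?_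
    · rintro _ ⟨w, hw, rfl⟩
      have := hball w hw.1
      exact this.1.trans this.2.le
    · exact convex_halfSpace_le l.toLinearMap.isLinear _
    · exact isClosed_le l.continuous continuous_const
  exact hsub hv'

/-- If `F` agrees on an open set `U` with a field `F'` continuous at `z`, and `z` is a limit point
of `U`, then `F' z` is a limit of values of `F` near `z` outside any given null set: a nonempty
open set is never null. -/
theorem mem_closure_image_ball_diff {F F' : Plane → Plane} {z : Plane} {U : Set Plane}
    (hU : IsOpen U) (hz : z ∈ closure U) (hF' : ContinuousAt F' z) (hFF' : EqOn F F' U)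
    {δ : ℝ} (hδ : 0 < δ) {N : Set Plane} (hN : volume N = 0) :
    F' z ∈ closure (F '' (Metric.ball z δ \ N)) := by
  refine mem_closure_iff_nhds.2 fun V hV => ?_
  obtain ⟨W, hWV, hWo, hzW⟩ := mem_nhds_iff.1 (hF' hV)
  have hne : ((W ∩ Metric.ball z δ) ∩ U).Nonempty :=
    mem_closure_iff.1 hz _ (hWo.inter Metric.isOpen_ball) ⟨hzW, Metric.mem_ball_self hδ⟩
  have hpos : volume ((W ∩ Metric.ball z δ) ∩ U) ≠ 0 :=
    (((hWo.inter Metric.isOpen_ball).inter hU).measure_pos volume hne).ne'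
  obtain ⟨w, hw, hwN⟩ : ∃ w ∈ (W ∩ Metric.ball z δ) ∩ U, w ∉ N := by
    by_contra! hcon
    exact hpos (measure_mono_null hcon hN)
  exact ⟨F w, by rw [hFF' hw.2]; exact hWV hw.1.1, w, ⟨hw.1.2, hwN⟩, rfl⟩

namespace CPGame

variable (G : CPGame)

/-- The velocities `-2αz - π u (1, 1)` at `z`, where `u` is a value at `S₁ z - S₂ z` of the
set-valued sign function: `u ∈ [-1, 1]`, with `u = 1` where `S₁ > S₂` and `u = -1` where
`S₁ < S₂`. This is minus the subdifferential of `αx x² + αy y² + π |x + y - b|`. -/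
def velocitySet (z : Plane) : Set Plane :=
  {v | ∃ u ∈ Icc (-1 : ℝ) 1, (G.S₂ z < G.S₁ z → u = 1) ∧ (G.S₁ z < G.S₂ z → u = -1) ∧
    v 0 = -2 * G.αx * z 0 - G.price * u ∧ v 1 = -2 * G.αy * z 1 - G.price * u}

theorem S₁_sub_S₂ (z : Plane) : G.S₁ z - G.S₂ z = 2 * (z 0 + z 1 - G.b) := by
  simp only [S₁, S₂, b]; ring

theorem continuous_S₁ : Continuous G.S₁ := by unfold S₁; fun_prop

theorem continuous_S₂ : Continuous G.S₂ := by unfold S₂; fun_prop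

theorem continuous_F₁ : Continuous G.F₁ := by unfold F₁; fun_prop

theorem continuous_F₂ : Continuous G.F₂ := by unfold F₂; fun_prop

variable {G}

theorem switchedField_of_lt {z : Plane} (h : G.S₂ z < G.S₁ z) :
    G.switchedField z = G.F₁ z := if_pos h.le

theorem switchedField_of_gt {z : Plane} (h : G.S₁ z < G.S₂ z) :
    G.switchedField z = G.F₂ z := if_neg h.not_ge

theorem filippovSet_switchedField_subset (hprice : 0 < G.price) (z : Plane) :
    filippovSet G.switchedField z ⊆ G.velocitySet z := by
  intro v hv
  let e (i : Fin 2) : Plane →L[ℝ] ℝ := EuclideanSpace.proj i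
  have he (i : Fin 2) (w : Plane) : e i w = w i := rfl
  have hlt : G.S₂ z < G.S₁ z → ∀ᶠ w in 𝓝 z, G.S₂ w < G.S₁ w := fun h =>
    G.continuous_S₂.continuousAt.eventually_lt G.continuous_S₁.continuousAt h
  have hgt : G.S₁ z < G.S₂ z → ∀ᶠ w in 𝓝 z, G.S₁ w < G.S₂ w := fun h =>
    G.continuous_S₁.continuousAt.eventually_lt G.continuous_S₂.continuousAt h
  have hswitch (w : Plane) : G.switchedField w = G.F₁ w ∨ G.switchedField w = G.F₂ w := by
    unfold switchedField; split_ifs <;> simp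
  have h1 : v 0 ≤ G.price - 2 * G.αx * z 0 := by
    refine le_of_mem_filippovSet hv (e 0) (g := fun w => G.price - 2 * G.αx * w 0)
      (by fun_prop) (Eventually.of_forall fun w => ?_)
    rcases hswitch w with h | h <;> rw [h, he] <;> simp [F₁, F₂]; linarith
  have h2 : -v 0 ≤ G.price + 2 * G.αx * z 0 := by
    refine le_of_mem_filippovSet hv (-e 0) (g := fun w => G.price + 2 * G.αx * w 0)
      (by fun_prop) (Eventually.of_forall fun w => ?_)
    rcases hswitch w with h | h <;> rw [h, neg_apply, he] <;> simp [F₁, F₂]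
    linarith
  have h3 : v 0 - v 1 ≤ 2 * G.αy * z 1 - 2 * G.αx * z 0 := by
    refine le_of_mem_filippovSet hv (e 0 - e 1)
      (g := fun w => 2 * G.αy * w 1 - 2 * G.αx * w 0)
      (by fun_prop) (Eventually.of_forall fun w => ?_)
    rcases hswitch w with h | h <;> rw [h, sub_apply, he, he] <;>
      simp [F₁, F₂]
  have h4 : v 1 - v 0 ≤ 2 * G.αx * z 0 - 2 * G.αy * z 1 := by
    refine le_of_mem_filippovSet hv (e 1 - e 0)
      (g := fun w => 2 * G.αx * w 0 - 2 * G.αy * w 1)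
      (by fun_prop) (Eventually.of_forall fun w => ?_)
    rcases hswitch w with h | h <;> rw [h, sub_apply, he, he] <;>
      simp [F₁, F₂]
  have h5 : G.S₂ z < G.S₁ z → v 0 ≤ -(G.price + 2 * G.αx * z 0) := fun h => by
    refine le_of_mem_filippovSet hv (e 0) (g := fun w => -(G.price + 2 * G.αx * w 0))
      (by fun_prop) ((hlt h).mono fun w hw => ?_)
    rw [switchedField_of_lt hw, he]; simp [F₁]
  have h6 : G.S₁ z < G.S₂ z → -v 0 ≤ -(G.price - 2 * G.αx * z 0) := fun h => by
    refine le_of_mem_filippovSet hv (-e 0) (g := fun w => -(G.price - 2 * G.αx * w 0))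
      (by fun_prop) ((hgt h).mono fun w hw => ?_)
    rw [switchedField_of_gt hw, neg_apply, he]; simp [F₂]
  have hu : G.price * (-(v 0 + 2 * G.αx * z 0) / G.price) = -(v 0 + 2 * G.αx * z 0) := by
    field_simp
  refine ⟨-(v 0 + 2 * G.αx * z 0) / G.price, ⟨?_, ?_⟩, fun h => ?_, fun h => ?_, ?_, ?_⟩
  · rw [le_div_iff₀ hprice]; linarith
  · rw [div_le_iff₀ hprice]; linarith
  · rw [div_eq_iff hprice.ne']; linarith [h5 h]
  · rw [div_eq_iff hprice.ne']; linarith [h6 h]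
  · rw [hu]; ring
  · rw [hu]; linarith

theorem mem_closure_S₂_lt_S₁ {z : Plane} (h : G.S₂ z ≤ G.S₁ z) :
    z ∈ closure {w | G.S₂ w < G.S₁ w} := by
  have hlim : Tendsto (fun t : ℝ => z + t • !₂[(1 : ℝ), 1]) (𝓝[>] 0) (𝓝 z) := by
    have : Continuous fun t : ℝ => z + t • !₂[(1 : ℝ), 1] := by fun_prop
    simpa using (this.tendsto 0).mono_left nhdsWithin_le_nhds
  refine mem_closure_of_tendsto hlim ?_
  filter_upwards [self_mem_nhdsWithin] with t (ht : 0 < t)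
  simp [S₁, S₂] at h ⊢; linarith

theorem mem_closure_S₁_lt_S₂ {z : Plane} (h : G.S₁ z ≤ G.S₂ z) :
    z ∈ closure {w | G.S₁ w < G.S₂ w} := by
  have hlim : Tendsto (fun t : ℝ => z - t • !₂[(1 : ℝ), 1]) (𝓝[>] 0) (𝓝 z) := by
    have : Continuous fun t : ℝ => z - t • !₂[(1 : ℝ), 1] := by fun_prop
    simpa using (this.tendsto 0).mono_left nhdsWithin_le_nhds
  refine mem_closure_of_tendsto hlim ?_
  filter_upwards [self_mem_nhdsWithin] with t (ht : 0 < t)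
  simp [S₁, S₂] at h ⊢; linarith

theorem velocitySet_subset_filippovSet (z : Plane) :
    G.velocitySet z ⊆ filippovSet G.switchedField z := by
  rintro v ⟨u, ⟨hu₁, hu₂⟩, hlt, hgt, hv₀, hv₁⟩
  simp only [filippovSet, mem_iInter]
  intro δ hδ N hN
  set C := closure (convexHull ℝ (G.switchedField '' (Metric.ball z δ \ N))) with hC
  have hsub : closure (G.switchedField '' (Metric.ball z δ \ N)) ⊆ C :=
    closure_mono (subset_convexHull ℝ _)
  have hF₁ : G.S₂ z ≤ G.S₁ z → G.F₁ z ∈ C := fun h =>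
    hsub (mem_closure_image_ball_diff (isOpen_lt G.continuous_S₂ G.continuous_S₁)
      (mem_closure_S₂_lt_S₁ h) G.continuous_F₁.continuousAt (fun _ hw => switchedField_of_lt hw)
      hδ hN)
  have hF₂ : G.S₁ z ≤ G.S₂ z → G.F₂ z ∈ C := fun h =>
    hsub (mem_closure_image_ball_diff (isOpen_lt G.continuous_S₁ G.continuous_S₂)
      (mem_closure_S₁_lt_S₂ h) G.continuous_F₂.continuousAt (fun _ hw => switchedField_of_gt hw)
      hδ hN)
  rcases lt_trichotomy (G.S₁ z) (G.S₂ z) with h | h | h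
  · convert hF₂ h.le using 1
    ext i; fin_cases i <;> simp [F₂, hv₀, hv₁, hgt h] <;> ring
  · have hconv : Convex ℝ C := (convex_convexHull ℝ _).closure
    convert hconv (hF₁ h.ge) (hF₂ h.le) (a := (1 + u) / 2) (b := (1 - u) / 2)
      (by linarith) (by linarith) (by ring) using 1
    ext i; fin_cases i <;> simp [F₁, F₂, hv₀, hv₁] <;> ring
  · convert hF₁ h.le using 1
    ext i; fin_cases i <;> simp [F₁, hv₀, hv₁, hlt h] <;> ring

theorem filippovSet_switchedField (hprice : 0 < G.price) (z : Plane) :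
    filippovSet G.switchedField z = G.velocitySet z :=
  (filippovSet_switchedField_subset hprice z).antisymm (velocitySet_subset_filippovSet z)

end CPGame

/-! ### Contraction of Filippov solutions -/

theorem AbsolutelyContinuousOnInterval.euclideanSpace_apply {ι : Type*} [Fintype ι]
    {f : ℝ → EuclideanSpace ℝ ι} {a b : ℝ} (hf : AbsolutelyContinuousOnInterval f a b) (i : ι) :
    AbsolutelyContinuousOnInterval (fun t => f t i) a b := by
  refine squeeze_zero (fun E => Finset.sum_nonneg fun _ _ => dist_nonneg)
    (fun E => Finset.sum_le_sum fun j _ => ?_) hf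
  rw [dist_eq_norm, dist_eq_norm]
  exact PiLp.norm_apply_le (f (E.2 j).1 - f (E.2 j).2) i

theorem AbsolutelyContinuousOnInterval.le_of_ae_deriv_nonpos {f : ℝ → ℝ} {T : ℝ} (hT : 0 ≤ T)
    (hf : AbsolutelyContinuousOnInterval f 0 T)
    (h : ∀ᵐ t ∂(volume.restrict (Ioi (0 : ℝ))), deriv f t ≤ 0) : f T ≤ f 0 := by
  have hint := hf.integral_deriv_eq_sub
  rw [intervalIntegral.integral_of_le hT] at hint
  have : ∫ t in Ioc 0 T, deriv f t ≤ 0 := by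
    refine integral_nonpos_of_ae ?_
    exact ae_restrict_of_ae_restrict_of_subset Ioc_subset_Ioi_self h
  linarith

namespace CPGame

variable {G : CPGame}

/-- The velocity set is strongly dissipative: `⟪v - v', z - z'⟫ ≤ -2m ‖z - z'‖²` whenever
`m ≤ αx, αy`. The two terms `π u (1, 1)` only help since the set-valued sign is monotone. -/
theorem dissipative_velocitySet (hprice : 0 < G.price) {m : ℝ} (hmx : m ≤ G.αx) (hmy : m ≤ G.αy)
    {z z' v v' : Plane} (hv : v ∈ G.velocitySet z) (hv' : v' ∈ G.velocitySet z') :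
    (v 0 - v' 0) * (z 0 - z' 0) + (v 1 - v' 1) * (z 1 - z' 1) ≤
      -2 * m * ((z 0 - z' 0) ^ 2 + (z 1 - z' 1) ^ 2) := by
  obtain ⟨u, ⟨hu₁, hu₂⟩, hlt, hgt, h₀, h₁⟩ := hv
  obtain ⟨u', ⟨hu₁', hu₂'⟩, hlt', hgt', h₀', h₁'⟩ := hv'
  have hs := G.S₁_sub_S₂ z
  have hs' := G.S₁_sub_S₂ z'
  have hmono : 0 ≤ (u - u') * ((z 0 + z 1) - (z' 0 + z' 1)) := by
    rcases lt_trichotomy (z 0 + z 1) (z' 0 + z' 1) with h | h | h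
    · refine mul_nonneg_of_nonpos_of_nonpos ?_ (by linarith)
      rcases lt_or_ge (z 0 + z 1) G.b with hb | hb
      · linarith [hgt (by linarith)]
      · linarith [hlt' (by linarith)]
    · rw [h]; simp
    · refine mul_nonneg ?_ (by linarith)
      rcases lt_or_ge (z' 0 + z' 1) G.b with hb | hb
      · linarith [hgt' (by linarith)]
      · linarith [hlt (by linarith)]
  rw [h₀, h₁, h₀', h₁']
  nlinarith [mul_nonneg hprice.le hmono, mul_nonneg (sub_nonneg.2 hmx) (sq_nonneg (z 0 - z' 0)),
    mul_nonneg (sub_nonneg.2 hmy) (sq_nonneg (z 1 - z' 1))]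

theorem norm_sub_le_of_isFilippovSolution (hprice : 0 < G.price) {m : ℝ} (hmx : m ≤ G.αx)
    (hmy : m ≤ G.αy) {z w : ℝ → Plane} (hz : IsFilippovSolution G.switchedField z)
    (hw : IsFilippovSolution G.switchedField w) {T : ℝ} (hT : 0 ≤ T) :
    ‖z T - w T‖ ≤ ‖z 0 - w 0‖ * Real.exp (-2 * m * T) := by
  let d (i : Fin 2) (t : ℝ) : ℝ := z t i - w t i
  let Q (t : ℝ) : ℝ := Real.exp (4 * m * t) * (d 0 t * d 0 t + d 1 t * d 1 t)
  have hd (i : Fin 2) : AbsolutelyContinuousOnInterval (d i) 0 T :=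
    ((hz.absolutelyContinuous T hT).euclideanSpace_apply i).sub
      ((hw.absolutelyContinuous T hT).euclideanSpace_apply i)
  have hexp : AbsolutelyContinuousOnInterval (fun t => Real.exp (4 * m * t)) 0 T :=
    ContDiffOn.absolutelyContinuousOnInterval (by fun_prop)
  have hQ : AbsolutelyContinuousOnInterval Q 0 T :=
    hexp.mul (((hd 0).mul (hd 0)).add ((hd 1).mul (hd 1)))
  have hle : Q T ≤ Q 0 := by
    refine hQ.le_of_ae_deriv_nonpos hT ?_
    filter_upwards [hz.hasDerivAt_ae, hw.hasDerivAt_ae] with t ⟨v, hv, hzv⟩ ⟨v', hv', hwv⟩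
    rw [filippovSet_switchedField hprice] at hv hv'
    have hder (i : Fin 2) : HasDerivAt (d i) (v i - v' i) t :=
      ((EuclideanSpace.proj i : Plane →L[ℝ] ℝ).hasFDerivAt.comp_hasDerivAt t hzv).sub
        ((EuclideanSpace.proj i : Plane →L[ℝ] ℝ).hasFDerivAt.comp_hasDerivAt t hwv)
    have hE : HasDerivAt (fun t => Real.exp (4 * m * t)) (Real.exp (4 * m * t) * (4 * m)) t := by
      simpa using ((hasDerivAt_id t).const_mul (4 * m)).exp
    have hQ' : HasDerivAt Q _ t :=
      hE.mul (((hder 0).mul (hder 0)).add ((hder 1).mul (hder 1)))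
    rw [hQ'.deriv]
    have hdis := dissipative_velocitySet hprice hmx hmy hv hv'
    have h2 := mul_le_mul_of_nonneg_left hdis (Real.exp_pos (4 * m * t)).le
    simp only [d]
    nlinarith [h2]
  have hnorm (t : ℝ) : ‖z t - w t‖ ^ 2 = d 0 t * d 0 t + d 1 t * d 1 t := by
    rw [EuclideanSpace.norm_sq_eq]; simp [d, Fin.sum_univ_two, sq]
  have hQ0 : Q 0 = ‖z 0 - w 0‖ ^ 2 := by simp [Q, hnorm]
  have hQT : Q T = (Real.exp (2 * m * T)) ^ 2 * ‖z T - w T‖ ^ 2 := by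
    rw [← Real.exp_nat_mul, hnorm]; simp only [Q]; push_cast; ring_nf
  rw [hQ0, hQT, ← mul_pow] at hle
  have := le_of_sq_le_sq hle (norm_nonneg _)
  rw [show -2 * m * T = -(2 * m * T) by ring, Real.exp_neg, ← div_eq_mul_inv,
    le_div_iff₀ (Real.exp_pos _), mul_comm]
  exact this

/-- A zero of the Filippov set is a rest point. -/
theorem isFilippovSolution_const {F : Plane → Plane} {p : Plane} (hp : 0 ∈ filippovSet F p) :
    IsFilippovSolution F fun _ => p where
  absolutelyContinuous _ _ :=
    (LipschitzWith.const p).lipschitzOnWith.absolutelyContinuousOnInterval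
  hasDerivAt_ae := Eventually.of_forall fun t => ⟨0, hp, hasDerivAt_const t p⟩

theorem isClassKL_mul_exp {c : ℝ} (hc : 0 < c) :
    IsClassKL fun r t => r * Real.exp (-c * t) where
  classK t _ :=
    { continuousOn := by fun_prop
      strictMonoOn := fun r _ s _ h => mul_lt_mul_of_pos_right h (Real.exp_pos _)
      map_zero := zero_mul _ }
  antitoneOn r hr s _ t _ hst := by
    refine mul_le_mul_of_nonneg_left (Real.exp_le_exp.2 ?_) hr
    nlinarith
  tendsto_zero r _ := by
    have h : Tendsto (fun t : ℝ => Real.exp (-c * t)) atTop (𝓝 0) :=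
      Real.tendsto_exp_atBot.comp (tendsto_id.const_mul_atTop_of_neg (by linarith))
    simpa using h.const_mul r

/-- Every rest point of the switched dynamics attracts all solutions exponentially. -/
theorem isGUAS_of_zero_mem (hprice : 0 < G.price) (hαx : 0 < G.αx) (hαy : 0 < G.αy) {p : Plane}
    (hp : 0 ∈ G.velocitySet p) (D : Set Plane) : IsGUAS G.switchedField D p := by
  have hm : 0 < min G.αx G.αy := lt_min hαx hαy
  refine ⟨fun r t => r * Real.exp (-(2 * min G.αx G.αy) * t), isClassKL_mul_exp (by positivity),
    fun z hz _ t ht => ?_⟩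
  have := norm_sub_le_of_isFilippovSolution hprice (min_le_left _ _) (min_le_right _ _) hz
    (isFilippovSolution_const (velocitySet_subset_filippovSet p hp)) ht
  simpa using this

end CPGame

theorem IsGUAS.tendsto {F : Plane → Plane} {D : Set Plane} {p : Plane} (h : IsGUAS F D p)
    {z : ℝ → Plane} (hz : IsFilippovSolution F z) (h0 : z 0 ∈ D) : Tendsto z atTop (𝓝 p) := by
  obtain ⟨β, hβ, hle⟩ := h
  refine tendsto_iff_norm_sub_tendsto_zero.2 ?_
  refine squeeze_zero' (Eventually.of_forall fun t => norm_nonneg _) ?_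
    (hβ.tendsto_zero ‖z 0 - p‖ (norm_nonneg _))
  filter_upwards [eventually_ge_atTop 0] with t ht using hle z hz h0 t ht

/-! ### The regularized equation -/

/-- Truncation of a real number to `[-R, R]`. -/
noncomputable def truncate (R s : ℝ) : ℝ := max (-R) (min R s)

theorem lipschitzWith_truncate (R : ℝ) : LipschitzWith 1 (truncate R) :=
  (LipschitzWith.id.const_min R).const_max (-R)

theorem abs_truncate_le {R : ℝ} (hR : 0 ≤ R) (s : ℝ) : |truncate R s| ≤ R :=
  abs_le.2 ⟨le_max_left _ _, max_le (by linarith) (min_le_left _ _)⟩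

theorem truncate_of_abs_le {R s : ℝ} (h : |s| ≤ R) : truncate R s = s := by
  have := abs_le.1 h
  rw [truncate, min_eq_right this.2, max_eq_right this.1]

theorem truncate_of_le {R s : ℝ} (hR : 0 ≤ R) (h : R ≤ s) : truncate R s = R := by
  rw [truncate, min_eq_left h, max_eq_right (by linarith)]

theorem truncate_of_le_neg {R s : ℝ} (h : s ≤ -R) : truncate R s = -R := by
  rw [truncate, max_eq_left ((min_le_right _ _).trans h)]

/-- The residual `s - truncate 1 s` is an outer normal of `[-1, 1]` at the truncation. -/
theorem truncate_normal {u : ℝ} (hu : |u| ≤ 1) (s : ℝ) :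
    0 ≤ (truncate 1 s - u) * (s - truncate 1 s) := by
  have hu' := abs_le.1 hu
  rcases le_total 1 s with h | h
  · rw [truncate_of_le zero_le_one h]
    exact mul_nonneg (by linarith) (by linarith)
  rcases le_total s (-1) with h' | h'
  · rw [truncate_of_le_neg h']
    exact mul_nonneg_of_nonpos_of_nonpos (by linarith) (by linarith)
  · rw [truncate_of_abs_le (abs_le.2 ⟨h', h⟩)]; simp

/-- Two saturations of different slopes `k, l` are jointly monotone up to an error of
order `1/k + 1/l`: writing `s = u / k + r`, `s' = u' / l + r'` with `u, u'` the saturated values,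
the residuals `r, r'` are normal to `[-1, 1]` at `u, u'`, so that `(u - u') * (r - r') ≥ 0`. -/
theorem saturation_almost_monotone {k l : ℝ} (hk : 0 < k) (hl : 0 < l) (s s' : ℝ) :
    -(2 * (1 / k + 1 / l)) ≤ (truncate 1 (k * s) - truncate 1 (l * s')) * (s - s') := by
  set u := truncate 1 (k * s)
  set u' := truncate 1 (l * s')
  have hu : |u| ≤ 1 := abs_truncate_le zero_le_one _
  have hu' : |u'| ≤ 1 := abs_truncate_le zero_le_one _
  have h1 := mul_nonneg (one_div_pos.2 hk).le (truncate_normal hu' (k * s))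
  have h2 := mul_nonneg (one_div_pos.2 hl).le (truncate_normal hu (l * s'))
  have e1 : 1 / k * ((u - u') * (k * s - u)) = (u - u') * (s - 1 / k * u) := by field_simp
  have e2 : 1 / l * ((u' - u) * (l * s' - u')) = (u' - u) * (s' - 1 / l * u') := by field_simp
  rw [e1] at h1
  rw [e2] at h2
  obtain ⟨hu1, hu2⟩ := abs_le.1 hu
  obtain ⟨hu1', hu2'⟩ := abs_le.1 hu'
  have b1 : -2 ≤ (u - u') * u := by nlinarith
  have b2 : -2 ≤ (u' - u) * u' := by nlinarith
  have c1 := mul_le_mul_of_nonneg_left b1 (one_div_pos.2 hk).le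
  have c2 := mul_le_mul_of_nonneg_left b2 (one_div_pos.2 hl).le
  nlinarith

/-- A bounded globally Lipschitz autonomous vector field has solutions on `[0, T]` for every
`T`. -/
theorem exists_hasDerivWithinAt_of_bounded_lipschitz {E : Type*} [NormedAddCommGroup E]
    [NormedSpace ℝ E] [CompleteSpace E] {f : E → E} {K M : ℝ≥0} (hf : LipschitzWith K f)
    (hM : ∀ x, ‖f x‖ ≤ M) (x₀ : E) {T : ℝ} (hT : 0 ≤ T) :
    ∃ γ : ℝ → E, γ 0 = x₀ ∧ ∀ t ∈ Icc 0 T, HasDerivWithinAt γ (f (γ t)) (Icc 0 T) t := by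
  have h : IsPicardLindelof (fun _ => f) (⟨0, le_rfl, hT⟩ : Icc 0 T) x₀
      (M * T.toNNReal) 0 M K :=
    { lipschitzOnWith := fun _ _ => hf.lipschitzOnWith
      continuousOn := fun _ _ => continuousOn_const
      norm_le := fun _ _ x _ => hM x
      mul_max_le := by simp [hT] }
  exact h.exists_eq_forall_mem_Icc_hasDerivWithinAt₀

/-- The barrier argument: if the velocity of `g` is negative on the level `R`, then `g` does not
cross `R` upwards. -/
theorem le_of_deriv_neg_on_level {g g' : ℝ → ℝ} {R T : ℝ}
    (hg : ∀ t ∈ Icc 0 T, HasDerivWithinAt g (g' t) (Icc 0 T) t) (h0 : g 0 ≤ R)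
    (hR : ∀ t, g t = R → g' t < 0) : ∀ t ∈ Icc 0 T, g t ≤ R := by
  refine image_le_of_deriv_right_lt_deriv_boundary (f' := g') (B := fun _ => R) (B' := fun _ => 0)
    (fun t ht => (hg t ht).continuousWithinAt) (fun t ht => ?_) h0
    (fun t => hasDerivAt_const t R) (fun t _ => hR t)
  exact (hg t ⟨ht.1, ht.2.le⟩).mono_of_mem_nhdsWithin (Icc_mem_nhdsGE_of_mem ht)

/-- The switched dynamics in coordinates, with the jump replaced by a saturation of slope `k`,
has solutions on `[0, T]` which stay in a square that depends neither on `k` nor on `T`. -/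
theorem exists_regularized_solution {α β π b k R T : ℝ} (hα : 0 < α) (hβ : 0 < β) (hπ : 0 < π)
    (hT : 0 ≤ T) {x₀ y₀ : ℝ} (hx₀ : |x₀| ≤ R) (hy₀ : |y₀| ≤ R)
    (hRα : π < 2 * α * R) (hRβ : π < 2 * β * R) :
    ∃ x y : ℝ → ℝ, x 0 = x₀ ∧ y 0 = y₀ ∧ ∀ t ∈ Icc 0 T, |x t| ≤ R ∧ |y t| ≤ R ∧
      HasDerivWithinAt x (-2 * α * x t - π * truncate 1 (k * (x t + y t - b))) (Icc 0 T) t ∧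
      HasDerivWithinAt y (-2 * β * y t - π * truncate 1 (k * (x t + y t - b))) (Icc 0 T) t := by
  have hR : 0 ≤ R := (abs_nonneg _).trans hx₀
  -- the coordinates in the linear part are truncated to make the field bounded
  let f : ℝ × ℝ → ℝ × ℝ := fun q =>
    (-2 * α * truncate R q.1 - π * truncate 1 (k * (q.1 + q.2 - b)),
      -2 * β * truncate R q.2 - π * truncate 1 (k * (q.1 + q.2 - b)))
  have hlin (c : ℝ) : LipschitzWith ‖c‖₊ (fun s : ℝ => c * s) := lipschitzWith_smul c
  have hsum : LipschitzWith (1 + 1) fun q : ℝ × ℝ => q.1 + q.2 - b := by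
    have := (LipschitzWith.prod_fst (α := ℝ) (β := ℝ)).add (LipschitzWith.prod_snd)
    exact (this.sub (LipschitzWith.const b)).weaken (by simp)
  have hsat := (hlin π).comp ((lipschitzWith_truncate 1).comp ((hlin k).comp hsum))
  have hf : ∃ K, LipschitzWith K f :=
    ⟨_, (((hlin (-2 * α)).comp ((lipschitzWith_truncate R).comp LipschitzWith.prod_fst)).sub
        hsat).prodMk
      (((hlin (-2 * β)).comp ((lipschitzWith_truncate R).comp LipschitzWith.prod_snd)).sub hsat)⟩
  obtain ⟨K, hK⟩ := hf
  have hbound (c s r : ℝ) (hc : 0 < c) :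
      |-2 * c * truncate R s - π * truncate 1 r| ≤ 2 * c * R + π := by
    have h1 := abs_le.1 (abs_truncate_le hR s)
    have h2 := abs_le.1 (abs_truncate_le zero_le_one r)
    rw [abs_le]; constructor <;> nlinarith
  have hM (q : ℝ × ℝ) : ‖f q‖ ≤ (⟨2 * (α + β) * R + π, by positivity⟩ : ℝ≥0) := by
    have h1 := hbound α q.1 (k * (q.1 + q.2 - b)) hα
    have h2 := hbound β q.2 (k * (q.1 + q.2 - b)) hβ
    have := mul_nonneg hα.le hR
    have := mul_nonneg hβ.le hR
    refine max_le ?_ ?_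
    · exact h1.trans (by change _ ≤ 2 * (α + β) * R + π; nlinarith)
    · exact h2.trans (by change _ ≤ 2 * (α + β) * R + π; nlinarith)
  obtain ⟨γ, hγ0, hγ⟩ := exists_hasDerivWithinAt_of_bounded_lipschitz hK hM (x₀, y₀) hT
  have hx (t : ℝ) (ht : t ∈ Icc 0 T) : HasDerivWithinAt (fun t => (γ t).1) _ (Icc 0 T) t :=
    (hγ t ht).fst
  have hy (t : ℝ) (ht : t ∈ Icc 0 T) : HasDerivWithinAt (fun t => (γ t).2) _ (Icc 0 T) t :=
    (hγ t ht).snd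
  have hγ1 : (γ 0).1 = x₀ := by rw [hγ0]
  have hγ2 : (γ 0).2 = y₀ := by rw [hγ0]
  have htop : truncate R R = R := truncate_of_le hR le_rfl
  have hbot : truncate R (-R) = -R := truncate_of_le_neg le_rfl
  have hsat (r : ℝ) := abs_le.1 (abs_truncate_le zero_le_one r)
  have hxR (t : ℝ) (ht : t ∈ Icc 0 T) : |(γ t).1| ≤ R := by
    rw [abs_le']
    refine ⟨le_of_deriv_neg_on_level hx ?_ (fun s hs => ?_) t ht,
      le_of_deriv_neg_on_level (fun s hs => (hx s hs).neg) ?_ (fun s hs => ?_) t ht⟩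
    · rw [hγ1]; exact (abs_le.1 hx₀).2
    · have := hsat (k * ((γ s).1 + (γ s).2 - b))
      simp only [f, hs, htop] at this ⊢; nlinarith
    · simp only [Pi.neg_apply, hγ1]; linarith [(abs_le.1 hx₀).1]
    · have := hsat (k * ((γ s).1 + (γ s).2 - b))
      have hs' : (γ s).1 = -R := by simp only [Pi.neg_apply] at hs; linarith
      simp only [f, hs', hbot] at this ⊢; nlinarith
  have hyR (t : ℝ) (ht : t ∈ Icc 0 T) : |(γ t).2| ≤ R := by
    rw [abs_le']
    refine ⟨le_of_deriv_neg_on_level hy ?_ (fun s hs => ?_) t ht,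
      le_of_deriv_neg_on_level (fun s hs => (hy s hs).neg) ?_ (fun s hs => ?_) t ht⟩
    · rw [hγ2]; exact (abs_le.1 hy₀).2
    · have := hsat (k * ((γ s).1 + (γ s).2 - b))
      simp only [f, hs, htop] at this ⊢; nlinarith
    · simp only [Pi.neg_apply, hγ2]; linarith [(abs_le.1 hy₀).1]
    · have := hsat (k * ((γ s).1 + (γ s).2 - b))
      have hs' : (γ s).2 = -R := by simp only [Pi.neg_apply] at hs; linarith
      simp only [f, hs', hbot] at this ⊢; nlinarith
  refine ⟨fun t => (γ t).1, fun t => (γ t).2, hγ1, hγ2, fun t ht => ⟨hxR t ht, hyR t ht, ?_, ?_⟩⟩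
  · simpa only [f, truncate_of_abs_le (hxR t ht)] using hx t ht
  · simpa only [f, truncate_of_abs_le (hyR t ht)] using hy t ht

/-- Solutions of the equations regularized with slopes `k` and `l` that start at the same point
differ at time `t` by `O(√((1/k + 1/l) t))`. -/
theorem regularized_solution_dist {α β π b k l T : ℝ} (hα : 0 < α) (hβ : 0 < β) (hπ : 0 < π)
    (hk : 0 < k) (hl : 0 < l) {x y x' y' : ℝ → ℝ} (hx0 : x 0 = x' 0) (hy0 : y 0 = y' 0)
    (hx : ∀ t ∈ Icc 0 T, HasDerivWithinAt x
      (-2 * α * x t - π * truncate 1 (k * (x t + y t - b))) (Icc 0 T) t)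
    (hy : ∀ t ∈ Icc 0 T, HasDerivWithinAt y
      (-2 * β * y t - π * truncate 1 (k * (x t + y t - b))) (Icc 0 T) t)
    (hx' : ∀ t ∈ Icc 0 T, HasDerivWithinAt x'
      (-2 * α * x' t - π * truncate 1 (l * (x' t + y' t - b))) (Icc 0 T) t)
    (hy' : ∀ t ∈ Icc 0 T, HasDerivWithinAt y'
      (-2 * β * y' t - π * truncate 1 (l * (x' t + y' t - b))) (Icc 0 T) t) :
    ∀ t ∈ Icc 0 T, (x t - x' t) ^ 2 + (y t - y' t) ^ 2 ≤ 4 * π * (1 / k + 1 / l) * t := by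
  have hD (t : ℝ) (ht : t ∈ Icc 0 T) :=
    (((hx t ht).sub (hx' t ht)).pow 2).add (((hy t ht).sub (hy' t ht)).pow 2)
  refine image_le_of_deriv_right_le_deriv_boundary
    (fun t ht => (hD t ht).continuousWithinAt)
    (fun t ht => (hD t ⟨ht.1, ht.2.le⟩).mono_of_mem_nhdsWithin (Icc_mem_nhdsGE_of_mem ht))
    (B' := fun _ => 4 * π * (1 / k + 1 / l)) ?_ (by fun_prop) (fun t _ => ?_) (fun t _ => ?_)
  · simp [hx0, hy0]
  · simpa using ((hasDerivAt_id t).const_mul (4 * π * (1 / k + 1 / l))).hasDerivWithinAt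
  · have h := mul_le_mul_of_nonneg_left
      (saturation_almost_monotone hk hl (x t + y t - b) (x' t + y' t - b)) hπ.le
    simp only [Pi.sub_apply]
    push_cast
    nlinarith [mul_nonneg hα.le (sq_nonneg (x t - x' t)), mul_nonneg hβ.le (sq_nonneg (y t - y' t))]

/-! ### Existence of Filippov solutions -/

/-- One-sided derivative bounds pass to pointwise limits: if `g n → G` pointwise and the
derivatives of the `g n` at `τ` are at most a quantity that tends to `c` as `n → ∞` and `τ → t`
jointly, then the derivative of `G` at `t` is at most `c`. -/
theorem deriv_limit_le {g : ℕ → ℝ → ℝ} {G : ℝ → ℝ} {g' B : ℕ × ℝ → ℝ} {t v c : ℝ}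
    (hlim : ∀ᶠ τ in 𝓝 t, Tendsto (fun n => g n τ) atTop (𝓝 (G τ)))
    (hder : ∀ᶠ p : ℕ × ℝ in atTop ×ˢ 𝓝 t, HasDerivAt (g p.1) (g' p) p.2)
    (hle : ∀ᶠ p : ℕ × ℝ in atTop ×ˢ 𝓝 t, g' p ≤ B p)
    (hB : Tendsto B (atTop ×ˢ 𝓝 t) (𝓝 c)) (hG : HasDerivAt G v t) : v ≤ c := by
  refine le_of_forall_pos_le_add fun ε hε => ?_
  have hB' : ∀ᶠ p in atTop ×ˢ 𝓝 t, B p < c + ε := hB.eventually_lt_const (by linarith)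
  obtain ⟨pa, hpa, pb, hpb, h⟩ := eventually_prod_iff.1 ((hder.and hle).and hB')
  obtain ⟨δ, hδ, hball⟩ := Metric.eventually_nhds_iff_ball.1 (hpb.and hlim)
  have hinc : ∀ τ ∈ Metric.ball t δ, t < τ → G τ - G t ≤ (c + ε) * (τ - t) := by
    intro τ hτ htτ
    have ht := Metric.mem_ball_self (x := t) hδ
    refine le_of_tendsto ((hball τ hτ).2.sub (hball t ht).2) (hpa.mono fun n hn => ?_)
    have hd (σ : ℝ) (hσ : σ ∈ Metric.ball t δ) := h hn (hball σ hσ).1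
    refine (convex_ball t δ).image_sub_le_mul_sub_of_deriv_le
      (fun σ hσ => (hd σ hσ).1.1.continuousAt.continuousWithinAt)
      (fun σ hσ => (hd σ (interior_subset hσ)).1.1.differentiableAt.differentiableWithinAt)
      (fun σ hσ => ?_) t ht τ hτ htτ.le
    have := hd σ (interior_subset hσ)
    rw [this.1.1.deriv]
    exact this.1.2.trans this.2.le
  have hslope : Tendsto (slope G t) (𝓝[>] t) (𝓝 v) :=
    (hasDerivAt_iff_tendsto_slope.1 hG).mono_left (nhdsWithin_mono _ fun τ hτ => ne_of_gt hτ)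
  refine le_of_tendsto hslope ?_
  filter_upwards [self_mem_nhdsWithin, nhdsWithin_le_nhds (Metric.ball_mem_nhds t hδ)]
    with τ (hτ : t < τ) hτδ
  rw [slope_def_field, div_le_iff₀ (by linarith)]
  exact hinc τ hτδ hτ

theorem deriv_limit_eq {g : ℕ → ℝ → ℝ} {G : ℝ → ℝ} {g' B : ℕ × ℝ → ℝ} {t v c : ℝ}
    (hlim : ∀ᶠ τ in 𝓝 t, Tendsto (fun n => g n τ) atTop (𝓝 (G τ)))
    (hder : ∀ᶠ p : ℕ × ℝ in atTop ×ˢ 𝓝 t, HasDerivAt (g p.1) (g' p) p.2)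
    (heq : ∀ᶠ p : ℕ × ℝ in atTop ×ˢ 𝓝 t, g' p = B p)
    (hB : Tendsto B (atTop ×ˢ 𝓝 t) (𝓝 c)) (hG : HasDerivAt G v t) : v = c := by
  refine le_antisymm (deriv_limit_le hlim hder (heq.mono fun _ h => h.le) hB hG) ?_
  have := deriv_limit_le (g := fun n τ => -g n τ) (g' := fun p => -g' p) (G := fun τ => -G τ)
    (hlim.mono fun _ h => h.neg) (hder.mono fun _ h => h.neg)
    (heq.mono fun _ h => (neg_inj.2 h).le) hB.neg hG.neg
  linarith

/-- Equi-Lipschitz functions that converge pointwise at `t` converge continuously at `t`. -/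
theorem tendsto_uncurry_of_lipschitz {g : ℕ → ℝ → ℝ} {M t a : ℝ}
    (hM : ∀ᶠ p : ℕ × ℝ in atTop ×ˢ 𝓝 t, |g p.1 p.2 - g p.1 t| ≤ M * |p.2 - t|)
    (hlim : Tendsto (fun n => g n t) atTop (𝓝 a)) :
    Tendsto (fun p : ℕ × ℝ => g p.1 p.2) (atTop ×ˢ 𝓝 t) (𝓝 a) := by
  have h1 : Tendsto (fun p : ℕ × ℝ => g p.1 t) (atTop ×ˢ 𝓝 t) (𝓝 a) := hlim.comp tendsto_fst
  have h2 : Tendsto (fun p : ℕ × ℝ => M * |p.2 - t|) (atTop ×ˢ 𝓝 t) (𝓝 0) := by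
    have : Tendsto (fun τ : ℝ => M * |τ - t|) (𝓝 t) (𝓝 0) := by
      have : Continuous fun τ : ℝ => M * |τ - t| := by fun_prop
      simpa using this.tendsto t
    exact this.comp tendsto_snd
  have h3 : Tendsto (fun p : ℕ × ℝ => g p.1 p.2 - g p.1 t) (atTop ×ˢ 𝓝 t) (𝓝 0) :=
    squeeze_zero_norm' hM h2
  simpa using h3.add h1

namespace CPGame

variable {G : CPGame}

/-- The coordinates of the approximating sequence: solutions on `[0, n + 1]` of the equation
regularized with slope `n + 1`, equi-Lipschitz, and converging pointwise. -/
theorem exists_approximation (hprice : 0 < G.price) (hαx : 0 < G.αx) (hαy : 0 < G.αy)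
    (x₀ y₀ : ℝ) :
    ∃ (M : ℝ) (x y : ℕ → ℝ → ℝ) (X Y : ℝ → ℝ), 0 ≤ M ∧ (∀ n, x n 0 = x₀) ∧ (∀ n, y n 0 = y₀) ∧
      (∀ n : ℕ, ∀ t ∈ Icc (0 : ℝ) (n + 1),
        HasDerivWithinAt (x n) (-2 * G.αx * x n t -
          G.price * truncate 1 ((n + 1) * (x n t + y n t - G.b))) (Icc 0 (n + 1)) t ∧
        HasDerivWithinAt (y n) (-2 * G.αy * y n t -
          G.price * truncate 1 ((n + 1) * (x n t + y n t - G.b))) (Icc 0 (n + 1)) t) ∧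
      (∀ n : ℕ, ∀ s ∈ Icc (0 : ℝ) (n + 1), ∀ t ∈ Icc (0 : ℝ) (n + 1),
        |x n t - x n s| ≤ M * |t - s| ∧ |y n t - y n s| ≤ M * |t - s|) ∧
      ∀ t, 0 ≤ t → Tendsto (fun n => x n t) atTop (𝓝 (X t)) ∧
        Tendsto (fun n => y n t) atTop (𝓝 (Y t)) := by
  -- a square that contains the starting point and that the flow of either period cannot leave
  set R := |x₀| + |y₀| + G.price / G.αx + G.price / G.αy with hRdef
  have hpx : 0 < G.price / G.αx := by positivity
  have hpy : 0 < G.price / G.αy := by positivity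
  have hRx : |x₀| ≤ R := by linarith [abs_nonneg y₀]
  have hRy : |y₀| ≤ R := by linarith [abs_nonneg x₀]
  have hRα : G.price < 2 * G.αx * R := by
    have : G.price / G.αx ≤ R := by linarith [abs_nonneg y₀, abs_nonneg x₀]
    rw [div_le_iff₀ hαx] at this; linarith
  have hRβ : G.price < 2 * G.αy * R := by
    have : G.price / G.αy ≤ R := by linarith [abs_nonneg y₀, abs_nonneg x₀]
    rw [div_le_iff₀ hαy] at this; linarith
  have hR : 0 ≤ R := (abs_nonneg _).trans hRx
  choose x y hx0 hy0 hxy using fun n : ℕ =>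
    exists_regularized_solution (b := G.b) (k := n + 1) (T := n + 1) hαx hαy hprice
      (by positivity) hRx hRy hRα hRβ
  have hbound (c s r : ℝ) (hc : 0 < c) (hs : |s| ≤ R) :
      |-2 * c * s - G.price * truncate 1 r| ≤ 2 * c * R + G.price := by
    have h1 := abs_le.1 hs
    have h2 := abs_le.1 (abs_truncate_le zero_le_one r)
    rw [abs_le]; constructor <;> nlinarith
  have hclose (t : ℝ) (ht : 0 ≤ t) (N n m : ℕ) (hn : ⌈t⌉₊ + N ≤ n) (hm : ⌈t⌉₊ + N ≤ m) :
      (x n t - x m t) ^ 2 + (y n t - y m t) ^ 2 ≤ 8 * G.price * t * (1 / ((N : ℝ) + 1)) := by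
    have hk : ∀ k : ℕ, ⌈t⌉₊ + N ≤ k → (⌈t⌉₊ : ℝ) ≤ (k : ℝ) + 1 ∧
        1 / ((k : ℝ) + 1) ≤ 1 / ((N : ℝ) + 1) := fun k hk => by
      have : ((⌈t⌉₊ + N : ℕ) : ℝ) ≤ k := by exact_mod_cast hk
      push_cast at this
      have hc : (0 : ℝ) ≤ (⌈t⌉₊ : ℝ) := by positivity
      have hN : (0 : ℝ) ≤ (N : ℝ) := by positivity
      exact ⟨by linarith, one_div_le_one_div_of_le (by positivity) (by linarith)⟩
    have hsub : ∀ k : ℕ, ⌈t⌉₊ + N ≤ k → Icc (0 : ℝ) ⌈t⌉₊ ⊆ Icc 0 (k + 1) := fun k h =>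
      Icc_subset_Icc_right (hk k h).1
    have := regularized_solution_dist (T := ⌈t⌉₊) (k := n + 1) (l := m + 1) (b := G.b)
      hαx hαy hprice
      (by positivity) (by positivity) ((hx0 n).trans (hx0 m).symm) ((hy0 n).trans (hy0 m).symm)
      (fun s hs => (hxy n s (hsub n hn hs)).2.2.1.mono (hsub n hn))
      (fun s hs => (hxy n s (hsub n hn hs)).2.2.2.mono (hsub n hn))
      (fun s hs => (hxy m s (hsub m hm hs)).2.2.1.mono (hsub m hm))
      (fun s hs => (hxy m s (hsub m hm hs)).2.2.2.mono (hsub m hm)) t ⟨ht, Nat.le_ceil t⟩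
    refine this.trans ?_
    have h1 : 1 / ((n : ℝ) + 1) + 1 / ((m : ℝ) + 1) ≤ 2 * (1 / ((N : ℝ) + 1)) := by
      linarith [(hk n hn).2, (hk m hm).2]
    have h2 := mul_le_mul_of_nonneg_left h1 (mul_nonneg hprice.le ht)
    linarith
  have hsqrt (t : ℝ) :
      Tendsto (fun N : ℕ => √(8 * G.price * t * (1 / ((N : ℝ) + 1)))) atTop (𝓝 0) := by
    have := (tendsto_one_div_add_atTop_nhds_zero_nat (𝕜 := ℝ)).const_mul (8 * G.price * t)
    simpa [Function.comp_def] using (Real.continuous_sqrt.tendsto _).comp this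
  have hcauchy (g : ℕ → ℝ → ℝ) (t : ℝ)
      (hg : ∀ N n m : ℕ, ⌈t⌉₊ + N ≤ n → ⌈t⌉₊ + N ≤ m →
        (g n t - g m t) ^ 2 ≤ 8 * G.price * t * (1 / ((N : ℝ) + 1))) :
      ∃ a, Tendsto (fun n => g n t) atTop (𝓝 a) := by
    have : CauchySeq fun n => g (n + ⌈t⌉₊) t :=
      cauchySeq_of_le_tendsto_0 _ (fun n m N hn hm => by
        rw [Real.dist_eq]
        exact Real.abs_le_sqrt (hg N _ _ (by omega) (by omega))) (hsqrt t)
    obtain ⟨a, ha⟩ := cauchySeq_tendsto_of_complete this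
    exact ⟨a, (tendsto_add_atTop_iff_nat ⌈t⌉₊).1 ha⟩
  have hlim (t : ℝ) : ∃ a b : ℝ, 0 ≤ t → Tendsto (fun n => x n t) atTop (𝓝 a) ∧
      Tendsto (fun n => y n t) atTop (𝓝 b) := by
    by_cases ht : 0 ≤ t
    · obtain ⟨a, ha⟩ := hcauchy x t fun N n m hn hm => by
        nlinarith [hclose t ht N n m hn hm, sq_nonneg (y n t - y m t)]
      obtain ⟨b, hb⟩ := hcauchy y t fun N n m hn hm => by
        nlinarith [hclose t ht N n m hn hm, sq_nonneg (x n t - x m t)]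
      exact ⟨a, b, fun _ => ⟨ha, hb⟩⟩
    · exact ⟨0, 0, fun h => absurd h ht⟩
  choose X Y hXY using hlim
  have hαR := mul_nonneg hαx.le hR
  have hβR := mul_nonneg hαy.le hR
  refine ⟨2 * (G.αx + G.αy) * R + G.price, x, y, X, Y, by positivity, hx0, hy0,
    fun n t ht => (hxy n t ht).2.2, fun n s hs t ht => ⟨?_, ?_⟩, hXY⟩
  · refine (convex_Icc (0 : ℝ) (n + 1)).norm_image_sub_le_of_norm_hasDerivWithin_le
      (fun r hr => (hxy n r hr).2.2.1) (fun r hr => ?_) hs ht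
    exact (hbound _ _ _ hαx (hxy n r hr).1).trans (by linarith)
  · refine (convex_Icc (0 : ℝ) (n + 1)).norm_image_sub_le_of_norm_hasDerivWithin_le
      (fun r hr => (hxy n r hr).2.2.2) (fun r hr => ?_) hs ht
    exact (hbound _ _ _ hαy (hxy n r hr).2.1).trans (by linarith)

theorem exists_isFilippovSolution (hprice : 0 < G.price) (hαx : 0 < G.αx) (hαy : 0 < G.αy)
    (z₀ : Plane) : ∃ z : ℝ → Plane, IsFilippovSolution G.switchedField z ∧ z 0 = z₀ := by
  obtain ⟨M, x, y, X, Y, hM, hx0, hy0, hder, hLip, hlim⟩ :=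
    exists_approximation hprice hαx hαy (z₀ 0) (z₀ 1)
  have hmem (s : ℝ) (hs : 0 ≤ s) : ∀ᶠ n : ℕ in atTop, s ∈ Icc (0 : ℝ) (n + 1) := by
    filter_upwards [eventually_ge_atTop ⌈s⌉₊] with n hn
    have : (⌈s⌉₊ : ℝ) ≤ n := by exact_mod_cast hn
    exact ⟨hs, by linarith [Nat.le_ceil s]⟩
  have hXLip (s t : ℝ) (hs : 0 ≤ s) (ht : 0 ≤ t) : |X t - X s| ≤ M * |t - s| :=
    le_of_tendsto ((hlim t ht).1.sub (hlim s hs).1).abs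
      (((hmem s hs).and (hmem t ht)).mono fun n h => (hLip n s h.1 t h.2).1)
  have hYLip (s t : ℝ) (hs : 0 ≤ s) (ht : 0 ≤ t) : |Y t - Y s| ≤ M * |t - s| :=
    le_of_tendsto ((hlim t ht).2.sub (hlim s hs).2).abs
      (((hmem s hs).and (hmem t ht)).mono fun n h => (hLip n s h.1 t h.2).2)
  let z (t : ℝ) : Plane := !₂[X t, Y t]
  have hzLip : LipschitzOnWith ⟨2 * M, by linarith⟩ z (Ici 0) := by
    refine LipschitzOnWith.of_dist_le_mul fun t ht s hs => ?_
    rw [EuclideanSpace.dist_eq, Fin.sum_univ_two]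
    refine Real.sqrt_le_iff.2 ⟨mul_nonneg NNReal.zero_le_coe dist_nonneg, ?_⟩
    have h1 := pow_le_pow_left₀ (abs_nonneg _) (hXLip s t hs ht) 2
    have h2 := pow_le_pow_left₀ (abs_nonneg _) (hYLip s t hs ht) 2
    change |X t - X s| ^ 2 + |Y t - Y s| ^ 2 ≤ (2 * M * |t - s|) ^ 2
    nlinarith [sq_nonneg (M * |t - s|)]
  refine ⟨z, ⟨fun T hT => ?_, ?_⟩, ?_⟩
  · refine (hzLip.mono ?_).absolutelyContinuousOnInterval
    rw [uIcc_of_le hT]; exact Icc_subset_Ici_self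
  · filter_upwards [(hzLip.mono Ioi_subset_Ici_self).ae_differentiableWithinAt_real
      measurableSet_Ioi, ae_restrict_mem measurableSet_Ioi] with t hdiff (ht : 0 < t)
    have hz := (hdiff.differentiableAt (Ioi_mem_nhds ht)).hasDerivAt
    set v := deriv z t
    refine ⟨v, velocitySet_subset_filippovSet _ ?_, hz⟩
    have hX : HasDerivAt X (v 0) t :=
      (EuclideanSpace.proj 0 : Plane →L[ℝ] ℝ).hasFDerivAt.comp_hasDerivAt t hz
    have hY : HasDerivAt Y (v 1) t :=
      (EuclideanSpace.proj 1 : Plane →L[ℝ] ℝ).hasFDerivAt.comp_hasDerivAt t hz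
    -- near `(∞, t)` the time lies in the interior of the interval of existence
    have hev : ∀ᶠ p : ℕ × ℝ in atTop ×ˢ 𝓝 t,
        t ∈ Icc (0 : ℝ) (p.1 + 1) ∧ Icc (0 : ℝ) (p.1 + 1) ∈ 𝓝 p.2 := by
      filter_upwards [(hmem (t + 1) (by linarith)).prod_mk
        ((Ioo_mem_nhds ht (lt_add_one t)))] with p ⟨hp1, hp2⟩
      exact ⟨⟨ht.le, by linarith [hp1.2]⟩, Icc_mem_nhds hp2.1 (by linarith [hp1.2, hp2.2])⟩
    have hxc : Tendsto (fun p : ℕ × ℝ => x p.1 p.2) (atTop ×ˢ 𝓝 t) (𝓝 (X t)) :=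
      tendsto_uncurry_of_lipschitz
        (hev.mono fun p hp => (hLip _ _ hp.1 _ (mem_of_mem_nhds hp.2)).1) (hlim t ht.le).1
    have hyc : Tendsto (fun p : ℕ × ℝ => y p.1 p.2) (atTop ×ˢ 𝓝 t) (𝓝 (Y t)) :=
      tendsto_uncurry_of_lipschitz
        (hev.mono fun p hp => (hLip _ _ hp.1 _ (mem_of_mem_nhds hp.2)).2) (hlim t ht.le).2
    have hxd : ∀ᶠ p : ℕ × ℝ in atTop ×ˢ 𝓝 t, HasDerivAt (x p.1) (-2 * G.αx * x p.1 p.2 -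
        G.price * truncate 1 ((p.1 + 1) * (x p.1 p.2 + y p.1 p.2 - G.b))) p.2 :=
      hev.mono fun p hp => (hder _ _ (mem_of_mem_nhds hp.2)).1.hasDerivAt hp.2
    have hyd : ∀ᶠ p : ℕ × ℝ in atTop ×ˢ 𝓝 t, HasDerivAt (y p.1) (-2 * G.αy * y p.1 p.2 -
        G.price * truncate 1 ((p.1 + 1) * (x p.1 p.2 + y p.1 p.2 - G.b))) p.2 :=
      hev.mono fun p hp => (hder _ _ (mem_of_mem_nhds hp.2)).2.hasDerivAt hp.2
    have hpos : ∀ᶠ τ in 𝓝 t, 0 ≤ τ := (eventually_gt_nhds ht).mono fun _ h => h.le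
    have hxl : ∀ᶠ τ in 𝓝 t, Tendsto (fun n => x n τ) atTop (𝓝 (X τ)) :=
      hpos.mono fun τ hτ => (hlim τ hτ).1
    have hyl : ∀ᶠ τ in 𝓝 t, Tendsto (fun n => y n τ) atTop (𝓝 (Y τ)) :=
      hpos.mono fun τ hτ => (hlim τ hτ).2
    have hsat (r : ℝ) := abs_le.1 (abs_truncate_le zero_le_one r)
    have hup : v 0 ≤ -2 * G.αx * X t + G.price :=
      deriv_limit_le hxl hxd
        (B := fun p => -2 * G.αx * x p.1 p.2 + G.price)
        (Eventually.of_forall fun p => by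
          nlinarith [(hsat ((p.1 + 1) * (x p.1 p.2 + y p.1 p.2 - G.b))).1])
        ((hxc.const_mul _).add_const _) hX
    have hlow : -v 0 ≤ 2 * G.αx * X t + G.price :=
      deriv_limit_le (hxl.mono fun _ h => h.neg)
        (hxd.mono fun _ h => h.neg)
        (B := fun p => 2 * G.αx * x p.1 p.2 + G.price)
        (Eventually.of_forall fun p => by
          nlinarith [(hsat ((p.1 + 1) * (x p.1 p.2 + y p.1 p.2 - G.b))).2])
        ((hxc.const_mul _).add_const _) hX.neg
    -- the saturation cancels in the difference of the two coordinates
    have hdiff : v 0 - v 1 = -2 * G.αx * X t - -2 * G.αy * Y t :=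
      deriv_limit_eq ((hxl.and hyl).mono fun _ h => h.1.sub h.2)
        ((hxd.and hyd).mono fun _ h => h.1.sub h.2)
        (B := fun p => -2 * G.αx * x p.1 p.2 - -2 * G.αy * y p.1 p.2)
        (Eventually.of_forall fun p => by ring)
        ((hxc.const_mul _).sub (hyc.const_mul _)) (hX.sub hY)
    have hgap : Tendsto (fun p : ℕ × ℝ => ((p.1 : ℝ) + 1)) (atTop ×ˢ 𝓝 t) atTop :=
      (tendsto_atTop_add_const_right _ _ tendsto_natCast_atTop_atTop).comp tendsto_fst
    have hsc := (hxc.add hyc).sub_const G.b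
    -- off the switching line the saturation is eventually attained
    have hpos' : G.b < X t + Y t → v 0 = -2 * G.αx * X t - G.price := fun h =>
      deriv_limit_eq hxl hxd
        (B := fun p => -2 * G.αx * x p.1 p.2 - G.price)
        (by
          filter_upwards [(hgap.atTop_mul_pos (sub_pos.2 h) hsc).eventually_ge_atTop 1] with p hp
          rw [truncate_of_le zero_le_one hp, mul_one])
        ((hxc.const_mul _).sub_const _) hX
    have hneg' : X t + Y t < G.b → v 0 = -2 * G.αx * X t + G.price := fun h =>
      deriv_limit_eq hxl hxd
        (B := fun p => -2 * G.αx * x p.1 p.2 + G.price)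
        (by
          filter_upwards [(hgap.atTop_mul_neg (sub_neg.2 h) hsc).eventually_le_atBot (-1)]
            with p hp
          rw [truncate_of_le_neg hp]; ring)
        ((hxc.const_mul _).add_const _) hX
    have hs := G.S₁_sub_S₂ (z t)
    have hz0 : z t 0 = X t := rfl
    have hz1 : z t 1 = Y t := rfl
    have hu : G.price * (-(v 0 + 2 * G.αx * X t) / G.price) = -(v 0 + 2 * G.αx * X t) := by
      field_simp
    refine ⟨-(v 0 + 2 * G.αx * X t) / G.price, ⟨?_, ?_⟩, fun h => ?_, fun h => ?_, ?_, ?_⟩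
    · rw [le_div_iff₀ hprice]; linarith
    · rw [div_le_iff₀ hprice]; linarith
    · rw [div_eq_iff hprice.ne']; linarith [hpos' (by linarith)]
    · rw [div_eq_iff hprice.ne']; linarith [hneg' (by linarith)]
    · rw [hu, hz0]; ring
    · rw [hu, hz1]; linarith
  · have h0 := hlim 0 le_rfl
    simp only [hx0, hy0, tendsto_const_nhds_iff] at h0
    ext i; fin_cases i
    · exact h0.1.symm
    · exact h0.2.symm

end CPGame

/-! ### The equilibrium point -/

namespace CPGame

variable {G : CPGame}

/-- In the concave game the equilibrium is the common zero of the two period-2 gradients, which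
lies strictly on the side of the switching line where period 2 is the peak. -/
theorem exists_equilibrium_of_lt (hprice : 0 < G.price) (hαx : 0 < G.αx) (hαy : 0 < G.αy)
    (hS₁ : 0 ≤ G.Sb₁) (h : G.rx + G.ry < G.b) :
    ∃ p ∈ G.Xs, G.F₂ p = 0 ∧ 0 ∈ G.velocitySet p := by
  have hrx : 2 * G.αx * G.rx = G.price := by unfold rx; field_simp
  have hry : 2 * G.αy * G.ry = G.price := by unfold ry; field_simp
  have hrx0 : 0 < G.rx := by unfold rx; positivity
  have hry0 : 0 < G.ry := by unfold ry; positivity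
  have hb : 2 * G.b = G.Sb₂ - G.Sb₁ := by unfold b; ring
  have hs := G.S₁_sub_S₂ !₂[G.rx, G.ry]
  simp only [Matrix.cons_val_zero, Matrix.cons_val_one] at hs
  refine ⟨!₂[G.rx, G.ry], ⟨?_, ?_⟩, ?_, -1, ⟨le_rfl, by norm_num⟩, fun h' => ?_, fun _ => rfl,
    ?_, ?_⟩
  · simp only [Matrix.cons_val_zero, Matrix.cons_val_one]
    positivity
  · simp only [Matrix.cons_val_zero, Matrix.cons_val_one]
    have : 0 < G.Sb₂ - G.rx - G.ry := by linarith
    positivity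
  · ext i; fin_cases i <;> simp [F₂] <;> linarith
  · linarith
  · simp; linarith
  · simp; linarith

/-- In the quasiconcave and non-concave games the equilibrium is the point of the switching line
`x + y = b` where the marginal penalties `αx x` and `αy y` agree. Their common value is at most
`π / 2` because `b ≤ rx + ry`, so that a convex combination of the two fields vanishes there. -/
theorem exists_equilibrium_of_le (hprice : 0 < G.price) (hαx : 0 < G.αx) (hαy : 0 < G.αy)
    (hS : G.Sb₁ < G.Sb₂) (hS₁ : 0 ≤ G.Sb₁) (h : G.b ≤ G.rx + G.ry) :
    ∃ p ∈ G.Xs, G.EqualPayoffs p ∧ 0 ∈ G.velocitySet p := by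
  have hb : 2 * G.b = G.Sb₂ - G.Sb₁ := by unfold b; ring
  have hb0 : 0 < G.b := by linarith
  have hsum : 0 < G.αx + G.αy := by positivity
  set c := G.αx * G.αy * G.b / (G.αx + G.αy) with hc
  set x := G.αy * G.b / (G.αx + G.αy) with hx
  set y := G.αx * G.b / (G.αx + G.αy) with hy
  have hx0 : 0 < x := by positivity
  have hy0 : 0 < y := by positivity
  have hc0 : 0 < c := by positivity
  have hαx' : G.αx * x = c := by rw [hx, hc]; ring
  have hαy' : G.αy * y = c := by rw [hy, hc]; ring
  have hxy : x + y = G.b := by rw [hx, hy]; field_simp; ring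
  have hcle : 2 * c ≤ G.price := by
    have hr : G.rx + G.ry = G.price * (G.αx + G.αy) / (2 * (G.αx * G.αy)) := by
      unfold rx ry; field_simp; ring
    rw [hr, le_div_iff₀ (by positivity)] at h
    rw [hc, mul_div_assoc', div_le_iff₀ hsum]
    linarith
  have hs := G.S₁_sub_S₂ !₂[x, y]
  simp only [Matrix.cons_val_zero, Matrix.cons_val_one] at hs
  have hu : G.price * (-(2 * c) / G.price) = -(2 * c) := by field_simp
  refine ⟨!₂[x, y], ⟨?_, ?_⟩, ?_, -(2 * c) / G.price, ⟨?_, ?_⟩, fun h' => ?_, fun h' => ?_,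
    ?_, ?_⟩
  · simp only [Matrix.cons_val_zero, Matrix.cons_val_one]
    positivity
  · simp only [Matrix.cons_val_zero, Matrix.cons_val_one]
    have : 0 < G.Sb₂ - x - y := by linarith
    positivity
  · have hS12 : G.X₁ + G.Y₁ + 2 * (x + y) = G.X₂ + G.Y₂ := by
      simp only [Sb₁, Sb₂] at hb; linarith
    simp only [EqualPayoffs, fx₁, fx₂, fy₁, fy₂, Matrix.cons_val_zero,
      Matrix.cons_val_one]
    linear_combination -G.price * hS12
  · rw [le_div_iff₀ hprice]; linarith
  · rw [div_le_iff₀ hprice]; linarith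
  · linarith
  · linarith
  · rw [hu]; simp; linarith
  · rw [hu]; simp; linarith

end CPGame

theorem theorem2 (G : CPGame) (hprice : 0 < G.price) (hαx : 0 < G.αx) (hαy : 0 < G.αy)
    (hS : G.Sb₁ < G.Sb₂) (hS₁ : 0 ≤ G.Sb₁) :
    -- from every starting point in the region there is exactly one solution on `[0, ∞)`
    (∀ z₀ ∈ G.Xs, ∃ z : ℝ → Plane, IsFilippovSolution G.switchedField z ∧ z 0 = z₀ ∧
      ∀ w : ℝ → Plane, IsFilippovSolution G.switchedField w → w 0 = z₀ →
        ∀ t : ℝ, 0 ≤ t → w t = z t) ∧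
    ∃ p ∈ G.Xs, G.IsEquilibriumPoint p ∧
      -- concave game: the gradient of period 2 vanishes at the limit
      (G.rx + G.ry < G.b → G.F₂ p = 0) ∧
      -- quasiconcave and non-concave games: the total payoffs in the two periods agree
      (G.b ≤ G.rx + G.ry → G.EqualPayoffs p) ∧
      IsGUAS G.switchedField G.Xs p ∧
      ∀ z : ℝ → Plane, IsFilippovSolution G.switchedField z → z 0 ∈ G.Xs →
        Tendsto z atTop (𝓝 p) := by
  refine ⟨fun z₀ _ => ?_, ?_⟩
  · obtain ⟨z, hz, hz0⟩ := CPGame.exists_isFilippovSolution hprice hαx hαy z₀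
    refine ⟨z, hz, hz0, fun w hw hw0 t ht => ?_⟩
    have := CPGame.norm_sub_le_of_isFilippovSolution hprice (min_le_left _ _) (min_le_right _ _)
      hw hz ht
    rw [hw0, hz0, sub_self, norm_zero, zero_mul] at this
    exact sub_eq_zero.1 (norm_le_zero_iff.1 this)
  · rcases lt_or_ge (G.rx + G.ry) G.b with h | h
    · obtain ⟨p, hp, hF, h0⟩ := CPGame.exists_equilibrium_of_lt hprice hαx hαy hS₁ h
      have hG := CPGame.isGUAS_of_zero_mem hprice hαx hαy h0 G.Xs
      exact ⟨p, hp, Or.inr hF, fun _ => hF, fun h' => absurd h h'.not_gt, hG,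
        fun z hz hz0 => hG.tendsto hz hz0⟩
    · obtain ⟨p, hp, hE, h0⟩ := CPGame.exists_equilibrium_of_le hprice hαx hαy hS hS₁ h
      have hG := CPGame.isGUAS_of_zero_mem hprice hαx hαy h0 G.Xs
      exact ⟨p, hp, Or.inl hE, fun h' => absurd h h'.not_ge, fun _ => hE, hG,
        fun z hz hz0 => hG.tendsto hz hz0⟩
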